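/- Let $(T,\mathfrak m)$ be a complete Noetherian local domain of mixed characteristic $(0,p)$ (that is, $p$ is a prime number, $T$ is $\mathfrak m$-adically complete and separated, $\operatorname{char} T=0$ and $\operatorname{char}(T/\mathfrak m)=p$) such that $pT$ is a prime ideal of $T$. Let $\mathfrak p\neq\mathfrak m$ be a non-maximal prime ideal of $T$ with $\mathfrak p\cap\mathbb Z=p\mathbb Z$ (the preimage of $\mathfrak p$ under $\mathbb Z\to T$), and let $\delta\in\mathfrak m\setminus\mathfrak p$. Then there exists a subring $A\subseteq T$ which is a Noetherian local domain with maximal ideal $\mathfrak m\cap A$ such that 1. the $(\mathfrak m\cap A)$-adic completion $\widehat A$ of $A$ is isomorphic to $T$ as an $A$-algebra; 2. $A\cap\mathfrak p=pA$; 3. $\delta t\in A$ for some unit $t$ of $T$. -/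

import Mathlib

-- For every `t` in `T` and `a ∉ P`, choose `x_{t,a} ∈ t + aT` so that the residues modulo `P` are
-- algebraically independent over `𝔽_p`. There is room for this: `δ`-adic expansions embed the
-- sequences of residue field elements into `T ⧸ P`, and `T` has no more elements than there are
-- such sequences.
--
-- An integer polynomial in the `x_{t,a}` with value in `P` vanishes modulo `p`, so `ℤ[x]` meets `P`
-- in `pℤ[x]`. As `pT` is prime, this passes to the ring `A` of fractions in `T` with denominator
-- outside `P`. By construction `A` is dense modulo each `aT` with `a ∉ P`, and closed under
-- division by its elements outside `P`. Hence ideals of `A` not inside `P` are contracted from `T`,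
-- which gives both noetherianity (Cohen's theorem) and the completion.

universe u v

/-! ### Transfinite choice of independent elements -/

open Cardinal in
/-- In a domain of uncountable cardinality over a countable field, one can pick an algebraically
independent family of representatives of at most `#D` subsets of full cardinality. -/
theorem exists_algebraicIndependent_forall_mem {F : Type v} {D ι : Type u} [Field F] [Countable F]
    [CommRing D] [IsDomain D] [Algebra F D] (hD : ℵ₀ < #D) (hι : #ι ≤ #D)
    (S : ι → Set D) (hS : ∀ i, #D ≤ #(S i)) :
    ∃ x : ι → D, (∀ i, x i ∈ S i) ∧ AlgebraicIndependent F x := by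
  -- Fewer than `#D` elements have fewer than `#D` elements algebraic over them, so `S i` is not
  -- exhausted.
  have step : ∀ (i : ι) (U : Set D), #U < #D →
      ∃ y ∈ S i, Transcendental (Algebra.adjoin F U) y := by
    intro i U hU
    by_contra! h
    have h1 : #(S i) ≤ #{y : D // IsAlgebraic (Algebra.adjoin F U) y} :=
      mk_le_mk_of_subset fun y hy => not_not.mp (h y hy)
    have h2 := Algebraic.cardinalMk_le_max (Algebra.adjoin F U) D
    have h3 := Algebra.lift_cardinalMk_adjoin_le F U
    have h4 : #(Algebra.adjoin F U) < #D := by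
      rw [← Cardinal.lift_lt.{u, v}]
      refine h3.trans_lt (max_lt (max_lt ?_ (Cardinal.lift_lt.mpr hU)) ?_)
      · refine (Cardinal.lift_le.mpr (mk_le_aleph0 (α := F))).trans_lt ?_
        simpa using hD
      · simpa using hD
    exact absurd ((hS i).trans (h1.trans h2)) (not_le.mpr (max_lt h4 hD))
  choose g hgS hg using step
  -- A well-order of minimal type makes every proper initial segment smaller than `ι`.
  obtain ⟨_, _, hord⟩ := Cardinal.exists_ord_eq_type_lt ι
  have small : ∀ (i : ι) (f : Set.Iio i → D), #(Set.range f) < #D := fun i f =>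
    mk_range_le.trans_lt ((mk_Iio_lt i hord).trans_le hι)
  let x : ι → D := (wellFounded_lt (α := ι)).fix fun i ih =>
    g i (Set.range fun j : Set.Iio i => ih j j.2) (small i _)
  have hx : ∀ i, x i = g i (Set.range fun j : Set.Iio i => x j) (small i _) := fun i =>
    (wellFounded_lt (α := ι)).fix_eq _ i
  refine ⟨x, fun i => hx i ▸ hgS i _ _, ?_⟩
  have key : ∀ s : Finset ι, AlgebraicIndepOn F x (s : Set ι) := by
    intro s
    induction s using Finset.induction_on_max with
    | empty =>
      simp only [Finset.coe_empty]
      exact algebraicIndependent_empty_type_iff.mpr (algebraMap F D).injective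
    | insert i s hs ih =>
      rw [Finset.coe_insert]
      refine ih.insert ?_
      have := hg i (Set.range fun j : Set.Iio i => x j) (small i _)
      rw [← hx i] at this
      refine this.of_tower_top_of_subalgebra_le (Algebra.adjoin_mono ?_)
      rintro _ ⟨j, hj, rfl⟩
      exact ⟨⟨j, hs j hj⟩, rfl⟩
  refine algebraicIndependent_of_finite_type fun t ht => ?_
  have := key ht.toFinset
  rwa [ht.coe_toFinset] at this

/-! ### Recognising a completion -/

/-- If `R ⧸ J ^ n → S ⧸ I ^ n` is bijective for all `n` and `S` is `I`-adically complete, then `S` is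
the `J`-adic completion of `R`. -/
theorem AdicCompletion.nonempty_algEquiv_of_comap_eq {R S : Type*} [CommRing R] [CommRing S]
    [Algebra R S] (J : Ideal R) (I : Ideal S) [IsAdicComplete I S]
    (hcomap : ∀ n, (I ^ n).comap (algebraMap R S) = J ^ n)
    (hsurj : ∀ (n : ℕ) (s : S), ∃ r : R, s - algebraMap R S r ∈ I ^ n) :
    Nonempty (AdicCompletion J R ≃ₐ[R] S) := by
  have hle : ∀ n, J ^ n ≤ (I ^ n).comap (Algebra.ofId R S) := fun n => (hcomap n).ge
  let f : (n : ℕ) → AdicCompletion J R →ₐ[R] S ⧸ I ^ n := fun n =>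
    (Ideal.quotientMapₐ (I ^ n) (Algebra.ofId R S) (hle n)).comp (AdicCompletion.evalₐ J n)
  have hf_mk : ∀ (n : ℕ) (a : AdicCompletion.AdicCauchySequence J R),
      f n (AdicCompletion.mk J R a) = Ideal.Quotient.mk (I ^ n) (algebraMap R S (a n)) := by
    intro n a
    simp only [f, AlgHom.comp_apply, AdicCompletion.evalₐ_mk]
    rfl
  have hf : ∀ {m n : ℕ} (hmn : m ≤ n),
      (Ideal.Quotient.factorₐ R (Ideal.pow_le_pow_right hmn)).comp (f n) = f m := by
    intro m n hmn
    ext x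
    obtain ⟨a, rfl⟩ := AdicCompletion.mk_surjective J R x
    rw [AlgHom.comp_apply, hf_mk, hf_mk]
    change Ideal.Quotient.mk (I ^ m) _ = _
    rw [Ideal.Quotient.eq, ← map_sub, ← Ideal.mem_comap, hcomap]
    have := a.property hmn
    rw [SModEq.comm, SModEq.sub_mem] at this
    simpa using this
  let φ := IsAdicComplete.liftAlgHom I f hf
  have hφ : ∀ n x, Ideal.Quotient.mk (I ^ n) (φ x) = f n x :=
    IsAdicComplete.mk_liftAlgHom I f hf
  refine ⟨AlgEquiv.ofBijective φ ⟨?_, ?_⟩⟩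
  · rw [injective_iff_map_eq_zero]
    intro x hx
    obtain ⟨a, rfl⟩ := AdicCompletion.mk_surjective J R x
    refine AdicCompletion.ext_evalₐ fun n => ?_
    have := hφ n (AdicCompletion.mk J R a)
    rw [hx, _root_.map_zero, hf_mk, eq_comm, Ideal.Quotient.eq_zero_iff_mem, ← Ideal.mem_comap,
      hcomap] at this
    rwa [AdicCompletion.evalₐ_mk, _root_.map_zero, Ideal.Quotient.eq_zero_iff_mem]
  · intro s
    choose r hr using fun n => hsurj n s
    let a := AdicCompletion.AdicCauchySequence.mk J R r fun n => by
      rw [SModEq.sub_mem, smul_eq_mul, Ideal.mul_top, ← hcomap, Ideal.mem_comap, map_sub]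
      have h := sub_mem (Ideal.pow_le_pow_right n.le_succ (hr (n + 1))) (hr n)
      rwa [sub_sub_sub_cancel_left] at h
    refine ⟨AdicCompletion.mk J R a, ?_⟩
    apply IsHausdorff.eq_iff_smodEq (I := I) |>.mpr
    intro n
    rw [SModEq.sub_mem, smul_eq_mul, Ideal.mul_top, ← Ideal.Quotient.eq, hφ, hf_mk,
      Ideal.Quotient.eq, ← neg_sub]
    exact neg_mem (hr n)

/-! ### Cardinality of `T` and of `T ⧸ P` -/

section

open IsLocalRing Cardinal

namespace IsLocalRing

variable {T : Type u} [CommRing T] [IsLocalRing T]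

/-- Every family of digits in the residue field is realised by a `δ`-adic expansion. -/
theorem exists_expansion [IsAdicComplete (maximalIdeal T) T] (σ : ResidueField T → T)
    {δ : T} (hδ : δ ∈ maximalIdeal T) :
    ∃ L : (ℕ → ResidueField T) → T, ∀ a, L a = σ (a 0) + δ * L (fun n => a (n + 1)) := by
  let f : (ℕ → ResidueField T) → ℕ → T := fun a n => ∑ i ∈ Finset.range n, σ (a i) * δ ^ i
  have hf : ∀ a, ∃ l : T, ∀ n, f a n - l ∈ maximalIdeal T ^ n := by
    intro a
    obtain ⟨l, hl⟩ := IsPrecomplete.prec (I := maximalIdeal T) (M := T) inferInstance (f := f a) (by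
      intro m n hmn
      rw [SModEq.comm, SModEq.sub_mem, smul_eq_mul, Ideal.mul_top,
        ← Finset.sum_Ico_eq_sub _ hmn]
      exact sum_mem fun i hi => Ideal.mul_mem_left _ _
        (Ideal.pow_le_pow_right (Finset.mem_Ico.mp hi).1 (Ideal.pow_mem_pow hδ i)))
    refine ⟨l, fun n => ?_⟩
    simpa [SModEq.sub_mem] using hl n
  choose L hL using hf
  refine ⟨L, fun a => ?_⟩
  apply IsHausdorff.eq_iff_smodEq (I := maximalIdeal T) |>.mpr
  intro n
  rw [SModEq.sub_mem, smul_eq_mul, Ideal.mul_top]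
  have h1 := Ideal.pow_le_pow_right n.le_succ (hL a (n + 1))
  have h2 := Ideal.mul_mem_left _ δ (hL (fun n => a (n + 1)) n)
  have h3 : f a (n + 1) = σ (a 0) + δ * f (fun n => a (n + 1)) n := by
    simp only [f, Finset.sum_range_succ', Finset.mul_sum]
    rw [add_comm]
    simp only [pow_zero, mul_one]
    congr 1
    exact Finset.sum_congr rfl fun i _ => by ring
  rw [h3] at h1
  convert sub_mem h2 h1 using 1
  ring

/-- Expansions congruent modulo `P` have equal digits: the leading one is read off modulo the
maximal ideal, then `δ ∉ P` is cancelled. -/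
theorem mk_residueField_seq_le [IsAdicComplete (maximalIdeal T) T]
    {P : Ideal T} [hP : P.IsPrime] {δ : T} (hδ : δ ∈ maximalIdeal T) (hδP : δ ∉ P) :
    #(ℕ → ResidueField T) ≤ #(T ⧸ P) := by
  obtain ⟨L, hL⟩ := exists_expansion (Function.surjInv (residue_surjective (R := T))) hδ
  have hPm : P ≤ maximalIdeal T := le_maximalIdeal hP.ne_top
  have h0 : ∀ a b, L a - L b ∈ P → a 0 = b 0 := by
    intro a b hab
    have h := hPm hab
    rw [← residue_eq_zero_iff, hL a, hL b] at h
    simpa [Function.surjInv_eq, (residue_eq_zero_iff δ).mpr hδ, sub_eq_zero] using h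
  have key : ∀ (n : ℕ) (a b), L a - L b ∈ P → a n = b n := by
    intro n
    induction n with
    | zero => exact h0
    | succ n ih =>
      intro a b hab
      refine ih (fun n => a (n + 1)) (fun n => b (n + 1)) ?_
      have h := h0 a b hab
      rw [hL a, hL b, h, add_sub_add_left_eq_sub, ← mul_sub] at hab
      exact (hP.mem_or_mem hab).resolve_left hδP
  refine mk_le_of_injective (f := fun a => Ideal.Quotient.mk P (L a)) fun a b hab => ?_
  exact funext fun n => key n a b (Ideal.Quotient.eq.mp hab)

theorem mk_residueField_seq : #(ℕ → ResidueField T) = #(ResidueField T) ^ ℵ₀ := by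
  simp

theorem aleph0_lt_mk_residueField_seq : ℵ₀ < #(ℕ → ResidueField T) := by
  rw [mk_residueField_seq]
  refine (cantor ℵ₀).trans_le (power_le_power_right ?_)
  exact two_le_iff.mpr (exists_pair_ne _)

/-- Each power of the maximal ideal is finitely generated, so representatives modulo the next power
need only finitely many more digits. Separatedness then bounds `#T` by `κ ^ ℵ₀ = κ`. -/
theorem mk_le_mk_residueField_seq [IsNoetherianRing T] [IsHausdorff (maximalIdeal T) T] :
    #T ≤ #(ℕ → ResidueField T) := by
  set κ := #(ℕ → ResidueField T) with hκ
  have hκ0 : ℵ₀ ≤ κ := aleph0_lt_mk_residueField_seq.le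
  have hS : ∀ n : ℕ, ∃ S : Set T, #S ≤ κ ∧ ∀ t, ∃ s ∈ S, t - s ∈ maximalIdeal T ^ n := by
    intro n
    induction n with
    | zero => exact ⟨{0}, by simpa using one_le_aleph0.trans hκ0, fun t => ⟨0, rfl, by simp⟩⟩
    | succ n ih =>
      obtain ⟨S, hSκ, hS⟩ := ih
      obtain ⟨G, hG⟩ := IsNoetherian.noetherian (maximalIdeal T ^ n)
      let σ := Function.surjInv (residue_surjective (R := T))
      let F : S × (G → ResidueField T) → T := fun x => x.1 + ∑ g : G, σ (x.2 g) * g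
      refine ⟨Set.range F, ?_, fun t => ?_⟩
      · refine mk_range_le.trans ?_
        rw [mk_prod, lift_id, lift_id]
        refine Cardinal.mul_le_of_le hκ0 hSκ ?_
        rw [hκ, mk_residueField_seq, ← Cardinal.power_def]
        exact power_le_power_left (mk_ne_zero _) (mk_le_aleph0)
      · obtain ⟨s, hs, hts⟩ := hS t
        rw [← hG, Submodule.mem_span_finset'] at hts
        obtain ⟨c, hc⟩ := hts
        refine ⟨_, ⟨(⟨s, hs⟩, fun g => residue T (c g)), rfl⟩, ?_⟩
        have : t - F (⟨s, hs⟩, fun g => residue T (c g))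
            = ∑ g : G, (c g - σ (residue T (c g))) * g := by
          simp only [F, sub_mul, Finset.sum_sub_distrib, ← sub_sub, ← hc, smul_eq_mul]
        rw [this, pow_succ']
        refine sum_mem fun g _ => Ideal.mul_mem_mul ?_ ?_
        · rw [← residue_eq_zero_iff, map_sub, Function.surjInv_eq residue_surjective, sub_self]
        · rw [← hG]; exact Submodule.subset_span g.2
  choose S hSκ hS using hS
  choose s hsS hs using hS
  calc #T ≤ #(∀ n, S n) := by
        refine mk_le_of_injective (f := fun t n => ⟨s n t, hsS n t⟩) fun t u htu => ?_
        apply IsHausdorff.eq_iff_smodEq (I := maximalIdeal T) |>.mpr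
        intro n
        rw [SModEq.sub_mem, smul_eq_mul, Ideal.mul_top]
        have h : s n t = s n u := congrArg Subtype.val (congrFun htu n)
        have := sub_mem (hs n t) (hs n u)
        rwa [h, sub_sub_sub_cancel_right] at this
    _ ≤ prod fun _ : ℕ => κ := by
        rw [mk_pi]
        exact prod_le_prod _ _ hSκ
    _ = κ := by
        rw [prod_const, hκ, mk_residueField_seq]
        simp [← Cardinal.power_mul]

end IsLocalRing

end

/-! ### Fractions with denominator outside `P` -/

/-- The elements of `T` that are fractions of elements of `R` with denominator outside `P`. -/
def Subring.fractionsOutside {T : Type*} [CommRing T] (R : Subring T) (P : Ideal T)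
    [hP : P.IsPrime] : Subring T where
  carrier := {t | ∃ g ∈ R, g ∉ P ∧ g * t ∈ R}
  mul_mem' := by
    rintro a b ⟨g, hg, hgP, hga⟩ ⟨h, hh, hhP, hhb⟩
    exact ⟨g * h, mul_mem hg hh, hP.mul_notMem hgP hhP, by
      rw [mul_mul_mul_comm]; exact mul_mem hga hhb⟩
  one_mem' := ⟨1, one_mem _, hP.one_notMem, by simp⟩
  add_mem' := by
    rintro a b ⟨g, hg, hgP, hga⟩ ⟨h, hh, hhP, hhb⟩
    refine ⟨g * h, mul_mem hg hh, hP.mul_notMem hgP hhP, ?_⟩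
    have := add_mem (mul_mem hh hga) (mul_mem hg hhb)
    rwa [show h * (g * a) + g * (h * b) = g * h * (a + b) by ring] at this
  zero_mem' := ⟨1, one_mem _, hP.one_notMem, by simp⟩
  neg_mem' := by
    rintro a ⟨g, hg, hgP, hga⟩
    exact ⟨g, hg, hgP, by rw [mul_neg]; exact neg_mem hga⟩

namespace Subring.fractionsOutside

variable {T : Type*} [CommRing T] (R : Subring T) (P : Ideal T) [hP : P.IsPrime]

theorem le : R ≤ R.fractionsOutside P := fun t ht => ⟨1, one_mem _, hP.one_notMem, by simpa using ht⟩

variable {R P}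

/-- The subring is closed under division by its elements outside `P`. -/
theorem mem_of_mul_mem {a t : T} (ha : a ∈ R.fractionsOutside P) (haP : a ∉ P)
    (hat : a * t ∈ R.fractionsOutside P) : t ∈ R.fractionsOutside P := by
  obtain ⟨g, hg, hgP, hga⟩ := ha
  obtain ⟨h, hh, hhP, hhb⟩ := hat
  refine ⟨h * (g * a), mul_mem hh hga, hP.mul_notMem hhP (hP.mul_notMem hgP haP), ?_⟩
  have := mul_mem hg hhb
  rwa [show g * (h * (a * t)) = h * (g * a) * t by ring] at this

theorem exists_eq_mul [IsDomain T] {p : T} (hp0 : p ≠ 0) (hpT : (Ideal.span {p}).IsPrime)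
    (hpP : p ∈ P) (hR : ∀ r ∈ R, r ∈ P → ∃ s ∈ R, r = p * s)
    {t : T} (ht : t ∈ R.fractionsOutside P) (htP : t ∈ P) :
    ∃ s ∈ R.fractionsOutside P, t = p * s := by
  obtain ⟨g, hg, hgP, hgt⟩ := ht
  obtain ⟨s, hs, h⟩ := hR _ hgt (P.mul_mem_left g htP)
  have h1 : g * t ∈ Ideal.span {p} := Ideal.mem_span_singleton.mpr ⟨s, h⟩
  have h2 : t ∈ Ideal.span {p} := (hpT.mem_or_mem h1).resolve_left fun hgp =>
    hgP ((Ideal.span_singleton_le_iff_mem P).mpr hpP hgp)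
  obtain ⟨u, rfl⟩ := Ideal.mem_span_singleton.mp h2
  refine ⟨u, ⟨g, hg, hgP, ?_⟩, rfl⟩
  have : g * u = s := mul_left_cancel₀ hp0 (by rw [← h]; ring)
  rwa [this]

end Subring.fractionsOutside

/-! ### Dense subrings: contraction, noetherianity, completion -/

/-- A subring of a domain that is dense modulo every principal ideal generated by one of its elements
outside `P`, closed under division by these elements, and whose contraction of `P` is principal. -/
structure Subring.IsDenseOutside {T : Type*} [CommRing T] (A : Subring T) (P : Ideal T)
    (p : T) : Prop where
  mem : p ∈ A
  mem_of_mul_mem : ∀ {a t : T}, a ∈ A → a ∉ P → a * t ∈ A → t ∈ A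
  exists_add : ∀ (t a : T), a ∉ P → ∃ x ∈ A, ∃ z, t = x + a * z
  exists_eq_mul : ∀ {t : T}, t ∈ A → t ∈ P → ∃ s ∈ A, t = p * s

namespace Subring.IsDenseOutside

open IsLocalRing

variable {T : Type*} [CommRing T] {A : Subring T} {P : Ideal T} {p : T}

theorem comap_eq_span (hA : A.IsDenseOutside P p) (hpP : p ∈ P) :
    P.comap A.subtype = Ideal.span {⟨p, hA.mem⟩} := by
  ext t
  rw [Ideal.mem_comap, Ideal.mem_span_singleton]
  constructor
  · intro h
    obtain ⟨s, hs, h⟩ := hA.exists_eq_mul t.2 h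
    exact ⟨⟨s, hs⟩, Subtype.ext h⟩
  · rintro ⟨s, rfl⟩
    exact P.mul_mem_right _ hpP

/-- Ideals not contained in `P` are contracted from `T`. -/
theorem comap_map_eq (hA : A.IsDenseOutside P p) {I : Ideal A} {a : A} (ha : a ∈ I)
    (haP : (a : T) ∉ P) : (I.map A.subtype).comap A.subtype = I := by
  refine le_antisymm (fun t ht => ?_) Ideal.le_comap_map
  have key : ∀ y ∈ I.map A.subtype, ∃ i ∈ I, ∃ z : T, y = (i : T) + a * z := by
    intro y hy
    induction hy using Submodule.span_induction with
    | mem y hy => obtain ⟨i, hi, rfl⟩ := hy; exact ⟨i, hi, 0, by simp⟩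
    | zero => exact ⟨0, zero_mem _, 0, by simp⟩
    | add y z _ _ hy hz =>
      obtain ⟨i, hi, u, rfl⟩ := hy
      obtain ⟨j, hj, v, rfl⟩ := hz
      exact ⟨i + j, add_mem hi hj, u + v, by push_cast; ring⟩
    -- Density splits the coefficient as `c = x + a * z` with `x ∈ A`; the rest is absorbed into the
    -- multiple of `a`.
    | smul c y _ hy =>
      obtain ⟨i, hi, u, rfl⟩ := hy
      obtain ⟨x, hx, z, rfl⟩ := hA.exists_add c a haP
      exact ⟨⟨x, hx⟩ * i, Ideal.mul_mem_left _ _ hi, z * i + (x + a * z) * u, by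
        simp only [smul_eq_mul, Subring.coe_mul]; ring⟩
  obtain ⟨i, hi, z, h⟩ := key _ ht
  have hz : z ∈ A := by
    refine hA.mem_of_mul_mem a.2 haP ?_
    have h' : (a : T) * z = ((t - i : A) : T) := by
      rw [AddSubgroupClass.coe_sub, eq_sub_iff_add_eq, add_comm]; exact h.symm
    rw [h']; exact (t - i).2
  have : t = i + a * ⟨z, hz⟩ := Subtype.ext h
  rw [this]
  exact add_mem hi (Ideal.mul_mem_right _ _ ha)

/-- By Cohen's theorem only nonzero primes `Q` matter. If `Q` lies in `P`, then `Q ≤ pA`; were `p ∉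
Q`, elements of `Q` would be divisible by `p` indefinitely, contradicting Krull's intersection
theorem. Otherwise `Q` is contracted from `T`, and generators of its extension can be taken in `Q`.
-/
theorem isNoetherianRing [IsDomain T] [IsNoetherianRing T] (hA : A.IsDenseOutside P p)
    [hP : P.IsPrime] (hpP : p ∈ P) : IsNoetherianRing A := by
  refine IsNoetherianRing.of_prime_ne_bot fun Q hQ hQ0 => ?_
  by_cases hQP : Q ≤ P.comap A.subtype
  · rw [hA.comap_eq_span hpP] at hQP
    by_cases hpQ : (⟨p, hA.mem⟩ : A) ∈ Q
    · rw [le_antisymm hQP ((Ideal.span_singleton_le_iff_mem Q).mpr hpQ)]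
      exact ⟨{⟨p, hA.mem⟩}, by simp⟩
    · refine absurd ?_ hQ0
      have key : ∀ n : ℕ, ∀ q ∈ Q, (q : T) ∈ Ideal.span {p} ^ n := by
        intro n
        induction n with
        | zero => simp
        | succ n ih =>
          intro q hq
          obtain ⟨s, rfl⟩ := Ideal.mem_span_singleton.mp (hQP hq)
          have hs := (hQ.mem_or_mem hq).resolve_left hpQ
          rw [pow_succ', Subring.coe_mul]
          exact Ideal.mul_mem_mul (Ideal.mem_span_singleton_self p) (ih s hs)
      refine (Submodule.eq_bot_iff _).mpr fun q hq => Subtype.ext ?_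
      have h : (q : T) ∈ ⨅ n : ℕ, Ideal.span {p} ^ n := by
        rw [Ideal.mem_iInf]; exact fun n => key n q hq
      have hne : Ideal.span {p} ≠ ⊤ := fun h => hP.ne_top
        (top_le_iff.mp (h ▸ (Ideal.span_singleton_le_iff_mem P).mpr hpP))
      rw [Ideal.iInf_pow_eq_bot_of_isDomain _ hne] at h
      exact h
  · obtain ⟨a, haQ, haP⟩ := Set.not_subset.mp hQP
    obtain ⟨s, hs, hspan⟩ := Submodule.fg_span_iff_fg_span_finset_subset (R := T)
      (A.subtype '' (Q : Set A)) |>.mp (IsNoetherian.noetherian (Q.map A.subtype))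
    classical
    obtain ⟨u, huQ, hu⟩ := Finset.subset_set_image_iff.mp hs
    refine ⟨insert a u, ?_⟩
    have hle : Ideal.span ((insert a u : Finset A) : Set A) ≤ Q := by
      rw [Ideal.span_le, Finset.coe_insert, Set.insert_subset_iff]
      exact ⟨haQ, huQ⟩
    have haI : a ∈ Ideal.span ((insert a u : Finset A) : Set A) :=
      Ideal.subset_span (by simp)
    refine le_antisymm hle ?_
    rw [← hA.comap_map_eq haI haP]
    rw [← Ideal.map_le_iff_le_comap]
    change Submodule.span T _ ≤ _
    rw [hspan, Submodule.span_le, ← hu]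
    intro y hy
    obtain ⟨i, hi, rfl⟩ := Finset.mem_image.mp hy
    exact Ideal.mem_map_of_mem _ (Ideal.subset_span (by simp [hi]))

variable [IsLocalRing T] [hP : P.IsPrime]

theorem isUnit_of_notMem (hA : A.IsDenseOutside P p) {a : A}
    (ha : (a : T) ∉ maximalIdeal T) : IsUnit a := by
  obtain ⟨b, hb⟩ := isUnit_iff_exists_inv.mp (notMem_maximalIdeal.mp ha)
  have hbA : b ∈ A := hA.mem_of_mul_mem a.2 (fun h => ha (le_maximalIdeal hP.ne_top h))
    (hb ▸ one_mem A)
  exact IsUnit.of_mul_eq_one ⟨b, hbA⟩ (Subtype.ext hb)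

theorem isLocalRing (hA : A.IsDenseOutside P p) : IsLocalRing A :=
  IsLocalRing.of_nonunits_add fun a b ha hb hab => by
    have h : ∀ c : A, c ∈ nonunits A → (c : T) ∈ maximalIdeal T := fun c hc => by
      by_contra h
      exact hc (hA.isUnit_of_notMem h)
    exact (mem_maximalIdeal _).mp (add_mem (h a ha) (h b hb)) (hab.map A.subtype)

theorem maximalIdeal_eq (hA : A.IsDenseOutside P p) [IsLocalRing A] :
    maximalIdeal A = (maximalIdeal T).comap A.subtype := by
  ext a
  rw [Ideal.mem_comap]
  constructor
  · intro ha
    by_contra h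
    exact (mem_maximalIdeal _).mp ha (hA.isUnit_of_notMem h)
  · intro ha h
    exact (mem_maximalIdeal _).mp ha (h.map A.subtype)

theorem nonempty_adicCompletion_algEquiv (hA : A.IsDenseOutside P p) [IsLocalRing A]
    [IsAdicComplete (maximalIdeal T) T] {a : T} (ha : a ∈ A) (ham : a ∈ maximalIdeal T)
    (haP : a ∉ P) : Nonempty (AdicCompletion (maximalIdeal A) A ≃ₐ[A] T) := by
  have hamA : (⟨a, ha⟩ : A) ∈ maximalIdeal A := by rw [hA.maximalIdeal_eq]; exact ham
  have hmap : (maximalIdeal A).map A.subtype = maximalIdeal T := by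
    refine le_antisymm (by rw [Ideal.map_le_iff_le_comap, hA.maximalIdeal_eq]) fun t ht => ?_
    obtain ⟨x, hx, z, rfl⟩ := hA.exists_add t a haP
    have haM : a ∈ (maximalIdeal A).map A.subtype := Ideal.mem_map_of_mem A.subtype hamA
    refine add_mem ?_ (Ideal.mul_mem_right _ _ haM)
    refine Ideal.mem_map_of_mem A.subtype (x := (⟨x, hx⟩ : A)) ?_
    rw [hA.maximalIdeal_eq, Ideal.mem_comap]
    have := sub_mem ht (Ideal.mul_mem_right z _ ham)
    rwa [add_sub_cancel_right] at this
  refine AdicCompletion.nonempty_algEquiv_of_comap_eq _ (maximalIdeal T) (fun n => ?_)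
    fun n t => ?_
  · have := hA.comap_map_eq (I := maximalIdeal A ^ n) (a := ⟨a, ha⟩ ^ n)
      (Ideal.pow_mem_pow hamA n) (fun h => haP (hP.mem_of_pow_mem n h))
    rwa [Ideal.map_pow, hmap] at this
  · obtain ⟨x, hx, z, rfl⟩ := hA.exists_add t (a ^ n) fun h => haP (hP.mem_of_pow_mem n h)
    refine ⟨⟨x, hx⟩, ?_⟩
    have : x + a ^ n * z - x ∈ maximalIdeal T ^ n := by
      rw [add_sub_cancel_left]
      exact Ideal.mul_mem_right _ _ (Ideal.pow_mem_pow ham n)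
    exact this

end Subring.IsDenseOutside

/-! ### Construction of `A` -/

section

open IsLocalRing Cardinal

/-- The subring generated by elements that are algebraically independent over `𝔽_p` modulo `P` meets
`P` in the multiples of `p`. -/
theorem exists_eq_mul_of_algebraicIndependent_mk {T : Type*} [CommRing T] {P : Ideal T} {p : ℕ}
    [Algebra (ZMod p) (T ⧸ P)] {ι : Type*} {x : ι → T}
    (hx : AlgebraicIndependent (ZMod p) fun i => Ideal.Quotient.mk P (x i)) :
    ∀ r ∈ (MvPolynomial.eval₂Hom (Int.castRingHom T) x).range, r ∈ P →
      ∃ s ∈ (MvPolynomial.eval₂Hom (Int.castRingHom T) x).range, r = p * s := by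
  rintro _ ⟨f, rfl⟩ hr
  have hcomp : (Ideal.Quotient.mk P).comp (MvPolynomial.eval₂Hom (Int.castRingHom T) x) =
      (MvPolynomial.aeval (R := ZMod p) fun i => Ideal.Quotient.mk P (x i)).toRingHom.comp
        (MvPolynomial.map (Int.castRingHom (ZMod p))) := by
    ext i
    · simp
    · simp
  have h0 : MvPolynomial.map (Int.castRingHom (ZMod p)) f = 0 := by
    refine (injective_iff_map_eq_zero _).mp hx _ ?_
    have := congrArg (fun φ => φ f) hcomp
    exact this.symm.trans (Ideal.Quotient.eq_zero_iff_mem.mpr hr)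
  obtain ⟨g, rfl⟩ := (MvPolynomial.C_dvd_iff_zmod p f).mpr h0
  exact ⟨_, ⟨g, rfl⟩, by rw [map_mul]; simp⟩

theorem exists_isDenseOutside {T : Type u} [CommRing T] [IsDomain T] [IsLocalRing T]
    [IsNoetherianRing T] [IsAdicComplete (maximalIdeal T) T] {p : ℕ} (hp : p.Prime) [CharZero T]
    (hpT : (Ideal.span {(p : T)}).IsPrime) {P : Ideal T} [hP : P.IsPrime] (hpP : (p : T) ∈ P)
    {δ : T} (hδ : δ ∈ maximalIdeal T) (hδP : δ ∉ P) :
    ∃ A : Subring T, A.IsDenseOutside P (p : T) := by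
  have : Fact p.Prime := ⟨hp⟩
  have : CharP (T ⧸ P) p := (CharP.charP_iff_prime_eq_zero hp).mpr <| by
    rw [← map_natCast (Ideal.Quotient.mk P)]
    exact Ideal.Quotient.eq_zero_iff_mem.mpr hpP
  let : Algebra (ZMod p) (T ⧸ P) := ZMod.algebra _ p
  have hD := mk_residueField_seq_le hδ hδP
  have hTD : #T ≤ #(T ⧸ P) := mk_le_mk_residueField_seq.trans hD
  have hω : ℵ₀ < #(T ⧸ P) := aleph0_lt_mk_residueField_seq.trans_le hD
  let S : T × {a : T // a ∉ P} → Set (T ⧸ P) := fun i =>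
    Set.range fun d => Ideal.Quotient.mk P i.1 + Ideal.Quotient.mk P i.2 * d
  obtain ⟨y, hyS, hy⟩ := exists_algebraicIndependent_forall_mem (F := ZMod p) hω
    (by
      rw [mk_prod, lift_id, lift_id]
      exact Cardinal.mul_le_of_le hω.le hTD ((mk_subtype_le _).trans hTD)) S
    -- Since `a ∉ P`, the map `d ↦ t + a * d` is injective on the domain `T ⧸ P`.
    (fun i => by
      refine (mk_range_eq _ fun d e hde => ?_).ge
      refine mul_left_cancel₀ ?_ (add_left_cancel hde)
      exact fun h => i.2.2 (Ideal.Quotient.eq_zero_iff_mem.mp h))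
  choose d hd using hyS
  choose z hz using fun i => Ideal.Quotient.mk_surjective (d i)
  let x : T × {a : T // a ∉ P} → T := fun i => i.1 + i.2 * z i
  have hx : AlgebraicIndependent (ZMod p) fun i => Ideal.Quotient.mk P (x i) := by
    have hxy : (fun i => Ideal.Quotient.mk P (x i)) = y := by
      ext i
      simp only [x, map_add, map_mul, hz, ← hd]
    rw [hxy]
    exact hy
  let R := (MvPolynomial.eval₂Hom (Int.castRingHom T) x).range
  refine ⟨R.fractionsOutside P, natCast_mem _ p,
    fun ha haP hat => Subring.fractionsOutside.mem_of_mul_mem ha haP hat, fun t a haP => ?_,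
    fun ht htP => Subring.fractionsOutside.exists_eq_mul (Nat.cast_ne_zero.mpr hp.ne_zero) hpT hpP
      (exists_eq_mul_of_algebraicIndependent_mk hx) ht htP⟩
  refine ⟨x (t, ⟨a, haP⟩), Subring.fractionsOutside.le R P ⟨MvPolynomial.X (t, ⟨a, haP⟩), by simp⟩,
    -z (t, ⟨a, haP⟩), ?_⟩
  simp only [x]
  ring

end

theorem theorem4p1 {T : Type*} [CommRing T] [IsDomain T] [IsLocalRing T] [IsNoetherianRing T]
    [IsAdicComplete (IsLocalRing.maximalIdeal T) T]
    (p : ℕ) (hp : p.Prime) [CharZero T] [CharP (IsLocalRing.ResidueField T) p]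
    (hpT : (Ideal.span {(p : T)}).IsPrime)
    (P : Ideal T) (hP : P.IsPrime) (hPm : P ≠ IsLocalRing.maximalIdeal T)
    (hPZ : P.comap (Int.castRingHom T) = Ideal.span {(p : ℤ)})
    (δ : T) (hδm : δ ∈ IsLocalRing.maximalIdeal T) (hδP : δ ∉ P) :
    ∃ A : Subring T,
      IsDomain A ∧ IsNoetherianRing A ∧
      (∃ _ : IsLocalRing A,
        IsLocalRing.maximalIdeal A = (IsLocalRing.maximalIdeal T).comap A.subtype ∧
        Nonempty (AdicCompletion (IsLocalRing.maximalIdeal A) A ≃ₐ[A] T)) ∧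
      P.comap A.subtype = Ideal.span {(p : A)} ∧
      ∃ t : Tˣ, δ * (t : T) ∈ A := by
  have hpP : (p : T) ∈ P := by
    have : (p : ℤ) ∈ P.comap (Int.castRingHom T) := hPZ ▸ Ideal.mem_span_singleton_self _
    simpa using this
  obtain ⟨A, hA⟩ := exists_isDenseOutside hp hpT hpP hδm hδP
  -- Approximating `δ` modulo `δ ^ 2` gives `x = δ * (1 - δ * z)`, a unit multiple of `δ`.
  obtain ⟨x, hx, z, h⟩ := hA.exists_add δ (δ * δ) (hP.mul_notMem hδP hδP)
  have hu : IsUnit (1 - δ * z) := by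
    by_contra hu
    refine (IsLocalRing.maximalIdeal.isMaximal T).ne_top ((Ideal.eq_top_iff_one _).mpr ?_)
    have := add_mem ((IsLocalRing.mem_maximalIdeal _).mpr hu) (Ideal.mul_mem_right z _ hδm)
    rwa [sub_add_cancel] at this
  obtain ⟨t, ht⟩ := hu
  have hδt : δ * (t : T) ∈ A := by
    rwa [ht, mul_sub, mul_one, ← mul_assoc, sub_eq_of_eq_add h]
  have hδtP : δ * (t : T) ∉ P := hP.mul_notMem hδP fun h => hP.ne_top (P.eq_top_of_isUnit_mem h t.isUnit)
  have := hA.isLocalRing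
  exact ⟨A, inferInstance, hA.isNoetherianRing hpP, ⟨this, hA.maximalIdeal_eq,
    hA.nonempty_adicCompletion_algEquiv hδt (Ideal.mul_mem_right _ _ hδm) hδtP⟩,
    hA.comap_eq_span hpP, t, hδt⟩
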